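/- Let $A$ be a $C^*$-algebra, not necessarily unital or separable, such that $K_0(A)$ and $K_1(A)$ are countable, and suppose that $A$ is nuclear: for every finite set $X\subset A$ and every $\varepsilon>0$ there are $k\ge 0$ and completely positive contractions $\psi:A\to M_k(\mathbb C)$, $\omega:M_k(\mathbb C)\to A$ with $\|\omega(\psi(a))-a\|<\varepsilon$ for all $a\in X$. Then there is an ascending sequence $F_1\subseteq F_2\subseteq F_3\subseteq\cdots$ of separable $C^*$-subalgebras of $A$ such that (i) for each $n$ the inclusion $\iota_n:F_n\to A$ induces surjections $K_0(F_n)\to K_0(A)$ and $K_1(F_n)\to K_1(A)$; (ii) the $C^*$-subalgebra $\theta A=\varinjlim F_n=\overline{\bigcup_n F_n}$ of $A$ is separable and nuclear; (iii) the inclusion $\iota:\theta A\to A$ is a weak $K$-equivalence, that is, it induces isomorphisms $K_0(\theta A)\to K_0(A)$ and $K_1(\theta A)\to K_1(A)$. -/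

import Mathlib

noncomputable section

/-! ## Operator `K`-theory of `C⋆`-algebras -/

namespace CStarKTheory

open Matrix

section MurrayVonNeumann

/-- Murray-von Neumann equivalence of square matrices, possibly of different sizes:
`p = v⋆ v` and `q = v v⋆` for some rectangular matrix `v`. -/
def MvN {B : Type*} [Ring B] [StarRing B] {m n : Type*} [Fintype m] [Fintype n]
    (p : Matrix m m B) (q : Matrix n n B) : Prop :=
  ∃ v : Matrix n m B, vᴴ * v = p ∧ v * vᴴ = q

variable {B : Type*} [Ring B] [StarRing B]
variable {k l m n : Type*} [Fintype k] [Fintype l] [Fintype m] [Fintype n]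

theorem MvN.symm {p : Matrix m m B} {q : Matrix n n B} (h : MvN p q) : MvN q p := by
  obtain ⟨v, h₁, h₂⟩ := h
  exact ⟨vᴴ, by simpa using h₂, by simpa using h₁⟩

theorem MvN.trans {p : Matrix l l B} {q : Matrix m m B} {r : Matrix n n B}
    (hp : p * p = p) (hr : r * r = r) (h : MvN p q) (h' : MvN q r) : MvN p r := by
  obtain ⟨v, h₁, h₂⟩ := h
  obtain ⟨w, h₃, h₄⟩ := h'
  refine ⟨w * v, ?_, ?_⟩
  · calc (w * v)ᴴ * (w * v) = vᴴ * (wᴴ * w) * v := by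
          simp only [conjTranspose_mul, Matrix.mul_assoc]
      _ = (vᴴ * v) * (vᴴ * v) := by rw [h₃, ← h₂]; simp only [Matrix.mul_assoc]
      _ = p := by rw [h₁, hp]
  · calc (w * v) * (w * v)ᴴ = w * (v * vᴴ) * wᴴ := by
          simp only [conjTranspose_mul, Matrix.mul_assoc]
      _ = (w * wᴴ) * (w * wᴴ) := by rw [h₂, ← h₃]; simp only [Matrix.mul_assoc]
      _ = r := by rw [h₄, hr]

theorem MvN.of_submatrix {p : Matrix m m B} (hp : IsStarProjection p) (e : n ≃ m) :
    MvN p (p.submatrix e e) := by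
  have hs : pᴴ = p := hp.isSelfAdjoint
  have hi : p * p = p := hp.isIdempotentElem
  refine ⟨p.submatrix e id, ?_, ?_⟩
  · rw [conjTranspose_submatrix, hs, submatrix_mul_equiv, hi, submatrix_id_id]
  · rw [conjTranspose_submatrix, hs, ← submatrix_mul _ _ _ _ _ Function.bijective_id, hi]

theorem MvN.fromBlocks {p : Matrix k k B} {q : Matrix l l B} {r : Matrix m m B}
    {s : Matrix n n B} (h : MvN p q) (h' : MvN r s) :
    MvN (Matrix.fromBlocks p 0 0 r) (Matrix.fromBlocks q 0 0 s) := by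
  obtain ⟨v, rfl, rfl⟩ := h
  obtain ⟨w, rfl, rfl⟩ := h'
  exact ⟨Matrix.fromBlocks v 0 0 w, by simp [fromBlocks_conjTranspose, fromBlocks_multiply],
    by simp [fromBlocks_conjTranspose, fromBlocks_multiply]⟩

theorem isStarProjection_fromBlocks {p : Matrix m m B} {q : Matrix n n B}
    (hp : IsStarProjection p) (hq : IsStarProjection q) :
    IsStarProjection (Matrix.fromBlocks p 0 0 q) := by
  have hs : pᴴ = p := hp.isSelfAdjoint
  have hi : p * p = p := hp.isIdempotentElem
  have hs' : qᴴ = q := hq.isSelfAdjoint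
  have hi' : q * q = q := hq.isIdempotentElem
  refine ⟨?_, ?_⟩
  · simp [IsIdempotentElem, fromBlocks_multiply, hi, hi']
  · simp [IsSelfAdjoint, star_eq_conjTranspose, fromBlocks_conjTranspose, hs, hs']

theorem isStarProjection_submatrix {p : Matrix m m B} (hp : IsStarProjection p) (e : n ≃ m) :
    IsStarProjection (p.submatrix e e) := by
  have hs : pᴴ = p := hp.isSelfAdjoint
  have hi : p * p = p := hp.isIdempotentElem
  refine ⟨?_, ?_⟩
  · rw [IsIdempotentElem, submatrix_mul_equiv, hi]
  · rw [IsSelfAdjoint, star_eq_conjTranspose, conjTranspose_submatrix, hs]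

end MurrayVonNeumann

section KZeroUnital

variable (B : Type*) [Ring B] [StarRing B]

/-- Projections in the matrix algebras `M_n(B)`, `n = 0, 1, 2, …`. -/
structure Proj where
  /-- The size `n` of the matrix. -/
  size : ℕ
  /-- The matrix. -/
  mat : Matrix (Fin size) (Fin size) B
  isProj : IsStarProjection mat

variable {B}

theorem Proj.mk_congr {n : ℕ} {p q : Matrix (Fin n) (Fin n) B} (hp : IsStarProjection p)
    (hq : IsStarProjection q) (h : p = q) : Proj.mk n p hp = Proj.mk n q hq := by
  subst h
  rfl

/-- The block diagonal sum `p ⊕ q` of two projections. -/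
def Proj.directSum (p q : Proj B) : Proj B :=
  ⟨p.size + q.size, (Matrix.fromBlocks p.mat 0 0 q.mat).submatrix finSumFinEquiv.symm
      finSumFinEquiv.symm,
    isStarProjection_submatrix (isStarProjection_fromBlocks p.isProj q.isProj) _⟩

theorem Proj.directSum_mvN (p q : Proj B) :
    MvN (Matrix.fromBlocks p.mat 0 0 q.mat) (p.directSum q).mat :=
  MvN.of_submatrix (isStarProjection_fromBlocks p.isProj q.isProj) _

theorem Proj.mvN_trans {p q : Proj B} {m : Type*} [Fintype m] {x : Matrix m m B}
    (h : MvN p.mat x) (h' : MvN x q.mat) : MvN p.mat q.mat :=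
  h.trans p.isProj.isIdempotentElem q.isProj.isIdempotentElem h'

variable (B) in
/-- Murray-von Neumann equivalence as an equivalence relation on projections. -/
instance projSetoid : Setoid (Proj B) where
  r p q := MvN p.mat q.mat
  iseqv :=
    { refl := fun p => by
        simpa using MvN.of_submatrix p.isProj (Equiv.refl _)
      symm := MvN.symm
      trans := Proj.mvN_trans }

theorem Proj.directSum_congr {p p' q q' : Proj B} (hp : p ≈ p') (hq : q ≈ q') :
    p.directSum q ≈ p'.directSum q' :=
  Proj.mvN_trans ((Proj.directSum_mvN p q).symm.trans (p.directSum q).isProj.isIdempotentElem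
    (isStarProjection_fromBlocks p'.isProj q'.isProj).isIdempotentElem (MvN.fromBlocks hp hq))
    (Proj.directSum_mvN p' q')

variable (B) in
/-- The Murray-von Neumann semigroup `V(B)`: classes of projections in matrices over `B`. -/
def V : Type _ := Quotient (projSetoid B)

/-- The class of a projection in `V(B)`. -/
def V.mk (p : Proj B) : V B := Quotient.mk _ p

theorem V.mk_eq_mk {p q : Proj B} : V.mk p = V.mk q ↔ MvN p.mat q.mat := Quotient.eq

instance : Zero (V B) := ⟨V.mk ⟨0, 0, IsStarProjection.zero _⟩⟩

instance : Add (V B) :=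
  ⟨Quotient.map₂ Proj.directSum fun _ _ hp _ _ hq => Proj.directSum_congr hp hq⟩

theorem V.mk_add_mk (p q : Proj B) : V.mk p + V.mk q = V.mk (p.directSum q) := rfl

theorem V.add_comm' (x y : V B) : x + y = y + x := by
  obtain ⟨p⟩ := x
  obtain ⟨q⟩ := y
  refine V.mk_eq_mk.2 (Proj.mvN_trans (Proj.directSum_mvN p q).symm
    (MvN.trans (isStarProjection_fromBlocks p.isProj q.isProj).isIdempotentElem
      (q.directSum p).isProj.isIdempotentElem ?_ (Proj.directSum_mvN q p)))
  have h := MvN.of_submatrix (isStarProjection_fromBlocks p.isProj q.isProj) (Equiv.sumComm _ _)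
  convert h using 1
  ext (i | i) (j | j) <;> rfl

theorem V.add_zero' (x : V B) : x + 0 = x := by
  obtain ⟨p⟩ := x
  refine V.mk_eq_mk.2 (Proj.mvN_trans (Proj.directSum_mvN p _).symm ?_)
  have h := MvN.of_submatrix (isStarProjection_fromBlocks p.isProj
    (IsStarProjection.zero (Matrix (Fin 0) (Fin 0) B))) (Equiv.sumEmpty _ _).symm
  exact h

theorem V.add_assoc' (x y z : V B) : x + y + z = x + (y + z) := by
  obtain ⟨p⟩ := x
  obtain ⟨q⟩ := y
  obtain ⟨r⟩ := z
  have hp := p.isProj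
  have hq := q.isProj
  have hr := r.isProj
  have hpq := isStarProjection_fromBlocks hp hq
  have hqr := isStarProjection_fromBlocks hq hr
  have refl (s : Proj B) : MvN s.mat s.mat := Setoid.refl s
  have h₁ := MvN.fromBlocks (Proj.directSum_mvN p q) (refl r)
  have h₂ := MvN.fromBlocks (refl p) (Proj.directSum_mvN q r)
  have h₃ := MvN.of_submatrix (isStarProjection_fromBlocks hpq hr) (Equiv.sumAssoc _ _ _).symm
  have h₄ : (Matrix.fromBlocks (Matrix.fromBlocks p.mat 0 0 q.mat) 0 0 r.mat).submatrix
      (Equiv.sumAssoc _ _ _).symm (Equiv.sumAssoc _ _ _).symm =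
      Matrix.fromBlocks p.mat 0 0 (Matrix.fromBlocks q.mat 0 0 r.mat) := by
    ext (i | i | i) (j | j | j) <;> rfl
  rw [h₄] at h₃
  have e₁ := (isStarProjection_fromBlocks hpq hr).isIdempotentElem
  have e₂ := (isStarProjection_fromBlocks hp hqr).isIdempotentElem
  have e₃ := (isStarProjection_fromBlocks hp (q.directSum r).isProj).isIdempotentElem
  refine V.mk_eq_mk.2 (Proj.mvN_trans (Proj.directSum_mvN (p.directSum q) r).symm ?_)
  refine MvN.trans (isStarProjection_fromBlocks (p.directSum q).isProj hr).isIdempotentElem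
    (p.directSum (q.directSum r)).isProj.isIdempotentElem h₁.symm ?_
  refine MvN.trans e₁ (p.directSum (q.directSum r)).isProj.isIdempotentElem (h₃.trans e₁ e₃ h₂) ?_
  exact Proj.directSum_mvN p (q.directSum r)

/-- `V(B)` is a commutative monoid under `[p] + [q] = [p ⊕ q]`. -/
instance : AddCommMonoid (V B) where
  nsmul := nsmulRec
  add_assoc := V.add_assoc'
  zero_add x := (V.add_comm' 0 x).trans (V.add_zero' x)
  add_zero := V.add_zero'
  add_comm := V.add_comm'

theorem isStarProjection_map {B C : Type*} [Ring B] [StarRing B] [Algebra ℂ B] [Ring C]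
    [StarRing C] [Algebra ℂ C] (φ : B →⋆ₐ[ℂ] C) {n : Type*} [Fintype n] {p : Matrix n n B}
    (hp : IsStarProjection p) : IsStarProjection (p.map φ) := by
  have hs : pᴴ = p := hp.isSelfAdjoint
  have hi : p * p = p := hp.isIdempotentElem
  refine ⟨?_, ?_⟩
  · rw [IsIdempotentElem, ← Matrix.map_mul, hi]
  · rw [IsSelfAdjoint, star_eq_conjTranspose, ← conjTranspose_map _ (map_star φ), hs]

end KZeroUnital

section KZeroMap

variable {A B C : Type*} [CStarAlgebra A] [CStarAlgebra B] [CStarAlgebra C]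

theorem MvN.map (φ : B →⋆ₐ[ℂ] C) {m n : Type*} [Fintype m] [Fintype n] {p : Matrix m m B}
    {q : Matrix n n B} (h : MvN p q) : MvN (p.map φ) (q.map φ) := by
  obtain ⟨v, h₁, h₂⟩ := h
  refine ⟨v.map φ, ?_, ?_⟩
  · rw [← conjTranspose_map φ (map_star φ), ← Matrix.map_mul, h₁]
  · rw [← conjTranspose_map φ (map_star φ), ← Matrix.map_mul, h₂]

theorem fromBlocks_submatrix_map (φ : B →⋆ₐ[ℂ] C) {l m n : Type*} (p : Matrix m m B)
    (q : Matrix n n B) (e : l → m ⊕ n) :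
    ((Matrix.fromBlocks p 0 0 q).submatrix e e).map φ =
      (Matrix.fromBlocks (p.map φ) 0 0 (q.map φ)).submatrix e e := by
  rw [← submatrix_map, fromBlocks_map, Matrix.map_zero _ (map_zero φ),
    Matrix.map_zero _ (map_zero φ)]

/-- The entrywise image of a projection under a unital `⋆`-homomorphism. -/
def Proj.map (φ : B →⋆ₐ[ℂ] C) (p : Proj B) : Proj C :=
  ⟨p.size, p.mat.map φ, isStarProjection_map φ p.isProj⟩

theorem Proj.map_congr (φ : B →⋆ₐ[ℂ] C) {p q : Proj B} (h : p ≈ q) : p.map φ ≈ q.map φ :=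
  MvN.map φ h

/-- The homomorphism `V(B) → V(C)` induced by a unital `⋆`-homomorphism `B → C`. -/
def V.map (φ : B →⋆ₐ[ℂ] C) : V B →+ V C where
  toFun := Quotient.map (Proj.map φ) fun _ _ h => Proj.map_congr φ h
  map_zero' := congrArg V.mk (by
    refine Proj.mk_congr _ _ ?_
    ext i
    exact i.elim0)
  map_add' := by
    rintro ⟨p⟩ ⟨q⟩
    refine congrArg V.mk (Proj.mk_congr _ _ ?_)
    exact fromBlocks_submatrix_map φ p.mat q.mat finSumFinEquiv.symm

theorem V.map_mk (φ : B →⋆ₐ[ℂ] C) (p : Proj B) : V.map φ (V.mk p) = V.mk (p.map φ) := rfl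

theorem V.map_comp (ψ : B →⋆ₐ[ℂ] C) (φ : A →⋆ₐ[ℂ] B) :
    V.map (ψ.comp φ) = (V.map ψ).comp (V.map φ) := by
  ext ⟨p⟩
  rfl

/-- `K₀` of a unital `C⋆`-algebra: the Grothendieck group of its Murray-von Neumann semigroup. -/
abbrev K0Unital (B : Type*) [CStarAlgebra B] : Type _ := Algebra.GrothendieckAddGroup (V B)

/-- The homomorphism on `K₀` induced by a unital `⋆`-homomorphism. -/
def K0Unital.map (φ : B →⋆ₐ[ℂ] C) : K0Unital B →+ K0Unital C :=
  Algebra.GrothendieckAddGroup.lift (Algebra.GrothendieckAddGroup.of.comp (V.map φ))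

theorem K0Unital.map_of (φ : B →⋆ₐ[ℂ] C) (x : V B) :
    K0Unital.map φ (Algebra.GrothendieckAddGroup.of x) =
      Algebra.GrothendieckAddGroup.of (V.map φ x) :=
  DFunLike.congr_fun (Algebra.GrothendieckAddGroup.lift.symm_apply_apply
    (Algebra.GrothendieckAddGroup.of.comp (V.map φ))) x

theorem K0Unital.map_comp (ψ : B →⋆ₐ[ℂ] C) (φ : A →⋆ₐ[ℂ] B) :
    K0Unital.map (ψ.comp φ) = (K0Unital.map ψ).comp (K0Unital.map φ) := by
  apply Algebra.GrothendieckAddGroup.lift.symm.injective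
  rw [K0Unital.map, Equiv.symm_apply_apply]
  ext x
  change _ = K0Unital.map ψ (K0Unital.map φ (Algebra.GrothendieckAddGroup.of x))
  rw [K0Unital.map_of, K0Unital.map_of, V.map_comp]
  rfl

end KZeroMap

section KZero

variable {A B : Type*} [NonUnitalCStarAlgebra A] [NonUnitalCStarAlgebra B]

/-- The scalar part `A⁺ → ℂ`, `a + λ1 ↦ λ`, of the unitization. -/
def scalarPart (A : Type*) [NonUnitalCStarAlgebra A] : Unitization ℂ A →⋆ₐ[ℂ] ℂ :=
  { Unitization.fstHom ℂ A with map_star' := fun _ => rfl }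

theorem scalarPart_comp_starMap (φ : A →⋆ₙₐ[ℂ] B) :
    (scalarPart B).comp (Unitization.starMap φ) = scalarPart A := by
  ext x
  change (Unitization.starMap φ (x : Unitization ℂ A)).fst = (x : Unitization ℂ A).fst
  simp

/-- `K₀(A)` of a `C⋆`-algebra `A`, unital or not: the kernel of `K₀(A⁺) → K₀(ℂ)`. -/
def K0 (A : Type*) [NonUnitalCStarAlgebra A] : AddSubgroup (K0Unital (Unitization ℂ A)) :=
  (K0Unital.map (scalarPart A)).ker

/-- The homomorphism `K₀(A) → K₀(B)` induced by a `⋆`-homomorphism `A → B`. -/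
def K0.map (φ : A →⋆ₙₐ[ℂ] B) : K0 A →+ K0 B :=
  ((K0Unital.map (Unitization.starMap φ)).comp (K0 A).subtype).codRestrict (K0 B) fun x => by
    have h : K0Unital.map (scalarPart A) x = 0 := x.2
    rw [← scalarPart_comp_starMap φ, K0Unital.map_comp] at h
    exact h

end KZero

section KOneUnital

variable {B C : Type*} [CStarAlgebra B] [CStarAlgebra C]

/-- The block diagonal matrix `diag(u, 1, …, 1)` of size `m ≥ n`. -/
def padMatrix {n m : ℕ} (_ : n ≤ m) (u : Matrix (Fin n) (Fin n) B) : Matrix (Fin m) (Fin m) B :=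
  fun i j => if hij : i.1 < n ∧ j.1 < n then u ⟨i.1, hij.1⟩ ⟨j.1, hij.2⟩ else if i = j then 1 else 0

theorem padMatrix_one {n m : ℕ} (h : n ≤ m) : padMatrix h (1 : Matrix (Fin n) (Fin n) B) = 1 := by
  ext i j
  simp only [padMatrix, Matrix.one_apply, Fin.ext_iff]
  split_ifs <;> rfl

theorem padMatrix_mul {n m : ℕ} (h : n ≤ m) (u v : Matrix (Fin n) (Fin n) B) :
    padMatrix h (u * v) = padMatrix h u * padMatrix h v := by
  ext i j
  rw [Matrix.mul_apply]
  by_cases hi : i.1 < n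
  · have key : ∑ k, u ⟨i, hi⟩ k * padMatrix h v (Fin.castLE h k) j =
        ∑ k, padMatrix h u i k * padMatrix h v k j := by
      refine Finset.sum_of_injOn (Fin.castLE h) (Fin.castLE_injective h).injOn
        (fun _ _ => Finset.mem_coe.2 (Finset.mem_univ _)) (fun k _ hk => ?_) (fun k _ => ?_)
      · have hk' : ¬ k.1 < n := fun h' => hk ⟨⟨k, h'⟩, by simp, rfl⟩
        have : i ≠ k := fun e => hk' (e ▸ hi)
        simp [padMatrix, hk', this]
      · simp [padMatrix, hi]
    rw [← key]
    by_cases hj : j.1 < n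
    · simp [padMatrix, hi, hj, Matrix.mul_apply]
    · have : ∀ k : Fin n, Fin.castLE h k ≠ j := fun k e => hj (by rw [← e]; exact k.2)
      have : i ≠ j := fun e => hj (e ▸ hi)
      simp [padMatrix, *]
  · have : ∀ k, padMatrix h u i k = if i = k then 1 else 0 := fun k => by simp [padMatrix, hi]
    simp [this]
    simp [padMatrix, hi]

theorem padMatrix_star {n m : ℕ} (h : n ≤ m) (u : Matrix (Fin n) (Fin n) B) :
    padMatrix h (star u) = star (padMatrix h u) := by
  ext i j
  simp only [padMatrix, Matrix.star_apply, and_comm (a := i.1 < n), eq_comm (a := i)]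
  split_ifs <;> simp

theorem padMatrix_map {n m : ℕ} (h : n ≤ m) (φ : B →⋆ₐ[ℂ] C) (u : Matrix (Fin n) (Fin n) B) :
    padMatrix h (u.map φ) = (padMatrix h u).map φ := by
  ext i j
  simp only [padMatrix, Matrix.map_apply]
  split_ifs <;> simp

theorem padMatrix_self {n : ℕ} (u : Matrix (Fin n) (Fin n) B) : padMatrix le_rfl u = u := by
  ext i j
  simp [padMatrix]

theorem padMatrix_padMatrix {n m k : ℕ} (h : n ≤ m) (h' : m ≤ k) (u : Matrix (Fin n) (Fin n) B) :
    padMatrix h' (padMatrix h u) = padMatrix (h.trans h') u := by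
  ext i j
  simp only [padMatrix, Fin.ext_iff]
  split_ifs <;> first | rfl | omega

theorem continuous_padMatrix {n m : ℕ} (h : n ≤ m) :
    Continuous (padMatrix h : Matrix (Fin n) (Fin n) B → Matrix (Fin m) (Fin m) B) := by
  refine continuous_matrix fun i j => ?_
  unfold padMatrix
  split_ifs <;> fun_prop

/-- The unitary group `U_n(B)` of `M_n(B)`. Its topology is that of entrywise convergence, which
is the topology of the `C⋆`-norm of `M_n(B)`. -/
abbrev U (B : Type*) [CStarAlgebra B] (n : ℕ) : Type _ := unitary (Matrix (Fin n) (Fin n) B)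

/-- The inclusion `U_n(B) → U_m(B)`, `u ↦ diag(u, 1, …, 1)`. -/
def U.pad {n m : ℕ} (h : n ≤ m) : U B n →* U B m where
  toFun u := ⟨padMatrix h u.1, by
    rw [Unitary.mem_iff, ← padMatrix_star, ← padMatrix_mul, ← padMatrix_mul,
      Unitary.star_mul_self_of_mem u.2, Unitary.mul_star_self_of_mem u.2, padMatrix_one]
    exact ⟨rfl, rfl⟩⟩
  map_one' := Subtype.ext (padMatrix_one h)
  map_mul' u v := Subtype.ext (padMatrix_mul h u.1 v.1)

theorem U.continuous_pad {n m : ℕ} (h : n ≤ m) : Continuous (U.pad h : U B n → U B m) :=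
  Continuous.subtype_mk ((continuous_padMatrix h).comp continuous_subtype_val) _

/-- The homomorphism `U_n(B) → U_n(C)` induced by a unital `⋆`-homomorphism. -/
def U.map (φ : B →⋆ₐ[ℂ] C) (n : ℕ) : U B n →* U C n where
  toFun u := ⟨u.1.map φ, by
    rw [Unitary.mem_iff, star_eq_conjTranspose, ← conjTranspose_map _ (map_star φ),
      ← Matrix.map_mul, ← Matrix.map_mul, ← star_eq_conjTranspose,
      Unitary.star_mul_self_of_mem u.2, Unitary.mul_star_self_of_mem u.2,
      Matrix.map_one _ (map_zero φ) (map_one φ)]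
    exact ⟨rfl, rfl⟩⟩
  map_one' := Subtype.ext (Matrix.map_one _ (map_zero φ) (map_one φ))
  map_mul' _ _ := Subtype.ext Matrix.map_mul

theorem U.continuous_map (φ : B →⋆ₐ[ℂ] C) (n : ℕ) : Continuous (U.map φ n) := by
  have hφ : Continuous φ :=
    AddMonoidHomClass.continuous_of_bound φ 1 fun x => by
      simpa using NonUnitalStarAlgHom.norm_apply_le φ x
  exact Continuous.subtype_mk (continuous_subtype_val.matrix_map hφ) _

/-- `U_n(B)₀`: the unitaries that are joined to `1` by a path of unitaries in `M_n(B)`. -/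
def U.identityComponent (B : Type*) [CStarAlgebra B] (n : ℕ) : Subgroup (U B n) where
  carrier := {u | Joined 1 u}
  one_mem' := Joined.refl 1
  mul_mem' := by
    rintro u v ⟨γ⟩ ⟨δ⟩
    exact ⟨(γ.mul δ).cast (mul_one 1).symm rfl⟩
  inv_mem' := by
    rintro u ⟨γ⟩
    exact ⟨γ.inv.cast inv_one.symm rfl⟩

instance (n : ℕ) : (U.identityComponent B n).Normal where
  conj_mem := by
    rintro u ⟨γ⟩ g
    exact ⟨(γ.map (f := fun x => g * x * g⁻¹) (by fun_prop)).cast (by simp) rfl⟩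

/-- The group `π₀(U_n(B)) = U_n(B) / U_n(B)₀`. -/
abbrev U.PiZero (B : Type*) [CStarAlgebra B] (n : ℕ) : Type _ := U B n ⧸ U.identityComponent B n

/-- The homomorphism `π₀(U_n(B)) → π₀(U_m(B))` given by `u ↦ diag(u, 1, …, 1)`. -/
def U.PiZero.pad (n m : ℕ) (h : n ≤ m) : U.PiZero B n →* U.PiZero B m :=
  QuotientGroup.map _ _ (U.pad h) (by
    rintro u ⟨γ⟩
    exact ⟨(γ.map (U.continuous_pad h)).cast (map_one _).symm rfl⟩)

/-- The homomorphism `π₀(U_n(B)) → π₀(U_n(C))` induced by a unital `⋆`-homomorphism. -/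
def U.PiZero.map (φ : B →⋆ₐ[ℂ] C) (n : ℕ) : U.PiZero B n →* U.PiZero C n :=
  QuotientGroup.map _ _ (U.map φ n) (by
    rintro u ⟨γ⟩
    exact ⟨(γ.map (U.continuous_map φ n)).cast (map_one _).symm rfl⟩)

instance : DirectedSystem (U.PiZero B) (U.PiZero.pad · · ·) where
  map_self := by
    rintro n ⟨u⟩
    exact congrArg (QuotientGroup.mk' _) (Subtype.ext (padMatrix_self u.1))
  map_map := by
    rintro k m n h h' ⟨u⟩
    exact congrArg (QuotientGroup.mk' _) (Subtype.ext (padMatrix_padMatrix h h' u.1))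

/-- `K₁` of a unital `C⋆`-algebra: the direct limit of the groups `U_n(B) / U_n(B)₀` along
`u ↦ diag(u, 1)`, written multiplicatively. -/
abbrev K1Unital (B : Type*) [CStarAlgebra B] : Type _ :=
  DirectLimit (U.PiZero B) (U.PiZero.pad (B := B))

/-- The homomorphism on `K₁` induced by a unital `⋆`-homomorphism. -/
def K1Unital.map (φ : B →⋆ₐ[ℂ] C) : K1Unital B →* K1Unital C :=
  MonoidHom.mk' (DirectLimit.map _ _ (fun n => U.PiZero.map φ n) (by
    rintro n m h ⟨u⟩
    exact congrArg (QuotientGroup.mk' _) (Subtype.ext (padMatrix_map h φ u.1)))) (by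
    refine DirectLimit.induction₂ _ fun n x y => ?_
    simp only [DirectLimit.mul_def, DirectLimit.map_def, map_mul])

end KOneUnital

section KOne

variable {A B : Type*} [NonUnitalCStarAlgebra A] [NonUnitalCStarAlgebra B]

/-- `K₁(A)` of a `C⋆`-algebra `A`, unital or not: `K₁` of the unitization `A⁺`. -/
abbrev K1 (A : Type*) [NonUnitalCStarAlgebra A] : Type _ := K1Unital (Unitization ℂ A)

/-- The homomorphism `K₁(A) → K₁(B)` induced by a `⋆`-homomorphism `A → B`. -/
def K1.map (φ : A →⋆ₙₐ[ℂ] B) : K1 A →* K1 B := K1Unital.map (Unitization.starMap φ)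

/-- A `⋆`-homomorphism is a weak `K`-equivalence if it induces an isomorphism on `K₀` and `K₁`. -/
def IsWeakKEquiv (φ : A →⋆ₙₐ[ℂ] B) : Prop :=
  Function.Bijective (K0.map φ) ∧ Function.Bijective (K1.map φ)

end KOne

end CStarKTheory

/-! ## Nuclearity -/

open scoped CStarAlgebra in
/-- A `C⋆`-algebra `A` is nuclear if its identity map is a point-norm limit of completely
positive contractions `A → M_k(ℂ) → A` (the completely positive approximation property).
Positivity in `A` is that of its `C⋆`-algebra structure. -/
def IsNuclearCStar (A : Type*) [NonUnitalCStarAlgebra A] : Prop :=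
  letI : PartialOrder A := CStarAlgebra.spectralOrder A
  haveI : StarOrderedRing A := CStarAlgebra.spectralOrderedRing A
  letI : PartialOrder ℂ := CStarAlgebra.spectralOrder ℂ
  haveI : StarOrderedRing ℂ := CStarAlgebra.spectralOrderedRing ℂ
  ∀ (X : Finset A) (ε : ℝ), 0 < ε →
    ∃ (k : ℕ) (ψ : A →CP CStarMatrix (Fin k) (Fin k) ℂ) (ω : CStarMatrix (Fin k) (Fin k) ℂ →CP A),
      (∀ a, ‖ψ a‖ ≤ ‖a‖) ∧ (∀ x, ‖ω x‖ ≤ ‖x‖) ∧ ∀ a ∈ X, ‖ω (ψ a) - a‖ < ε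

end

/-!
A separable subalgebra `θ ⊆ A` is built by a Löwenheim–Skolem closing-off argument. Each property
that `θ` needs has the form "if some witness exists over `A`, then one exists over `θ`", and each
can be relaxed to an approximate, open condition on finitely many parameters. It is then enough to
provide witnesses for a countable dense set of parameters at each of countably many stages; this is
`exists_closing_off`. Parameters are finite tuples in `Unitization ℂ A`, where `K`-theory is
computed. The stages are the algebras `F n`, and `θ` is the closure of their union.

* *Surjectivity on `K`-theory.* `K₀(A)` and `K₁(A)` are countable, and a class in either of them is
  given by finitely many matrix entries. These entries are put into the first stage, so that
  surjectivity already holds for every `F n`.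
* *Injectivity on `K₀`.* It suffices that projections `p`, `q` over the unitization of `θ` which are
  Murray-von Neumann equivalent over that of `A` are so over that of `θ`. If `v⋆v` and `vv⋆` are
  merely close to `p` and `q`, the polar part of `qvp` is an exact partial isometry
  (`exists_partialIsometry_of_norm_sub_lt`), so approximate witnesses `v` suffice.
* *Injectivity on `K₁`.* A unitary is connected to `1` if and only if it is a finite product of
  exponentials `exp (i h)` with `h` self-adjoint, and a unitary at distance less than `2` from such
  a product is connected to `1` too. So finite lists of self-adjoint matrices serve as witnesses.
* *Nuclearity.* The witness for a finite set and a tolerance is the map `M_k(ℂ) → A` of a completely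
  positive factorization; its range is finite-dimensional, hence spanned by finitely many elements.
  The map remains completely positive into `θ`, because an injective `⋆`-homomorphism reflects
  positivity (`nonneg_of_map_nonneg`).

No approximation within the stages themselves is needed: projections and unitaries over `θ` are
never replaced by projections and unitaries over some `F n`.
-/

open CStarKTheory Topology TopologicalSpace

/-! ### Approximate partial isometries, positivity and products of exponentials -/

/-- If `v⋆v` and `vv⋆` are close to projections `p` and `q`, then `p` and `q` are Murray-von Neumann
equivalent: with `w = q v p` and `h = w⋆w + (1 - p)`, which is positive and invertible, the partial
isometry is `w h^(-1/2)`. -/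
theorem exists_partialIsometry_of_norm_sub_lt {D : Type*} [CStarAlgebra D] {p q v : D}
    (hp : IsStarProjection p) (hq : IsStarProjection q) (h₁ : ‖star v * v - p‖ < 1 / 10)
    (h₂ : ‖v * star v - q‖ < 1 / 10) : ∃ u : D, star u * u = p ∧ u * star u = q := by
  let _ : PartialOrder D := CStarAlgebra.spectralOrder D
  have : StarOrderedRing D := CStarAlgebra.spectralOrderedRing D
  -- `w⋆w` is within distance `1` of `p`; by symmetry the same bound serves for `ww⋆` and `q`.
  have close : ∀ {p q v : D}, IsStarProjection p → IsStarProjection q →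
      ‖star v * v - p‖ < 1 / 10 → ‖v * star v - q‖ < 1 / 10 →
      ‖star (q * v * p) * (q * v * p) - p‖ < 1 := by
    intro p q v hp hq h₁ h₂
    have hpp : p * p = p := hp.isIdempotentElem
    have hqq : q * q = q := hq.isIdempotentElem
    have hps : star p = p := hp.isSelfAdjoint
    have hqs : star q = q := hq.isSelfAdjoint
    have np : ‖p‖ ≤ 1 := hp.norm_le
    have na : ‖star v * v‖ ≤ 11 / 10 := by
      have := norm_add_le (star v * v - p) p
      rw [sub_add_cancel] at this
      linarith
    have nv : ‖v‖ * ‖v‖ ≤ 11 / 10 := by rwa [← CStarRing.norm_star_mul_self]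
    have e : star (q * v * p) * (q * v * p) - p =
        -(p * (star v * (v * star v - q) * v) * p) +
          p * ((star v * v - p) * (star v * v) + p * (star v * v - p)) * p := by
      simp only [star_mul, hps, hqs]
      have : p * (star v * q) * (q * v * p) = p * (star v * (q * q) * v) * p := by
        simp only [mul_assoc]
      rw [this, hqq]
      simp only [mul_sub, sub_mul, mul_add, add_mul, mul_assoc, hpp]
      simp only [← mul_assoc, hpp]
      abel
    have sandwich : ∀ x : D, ‖p * x * p‖ ≤ ‖x‖ := fun x => by
      refine (norm_mul_le _ _).trans ?_
      refine (mul_le_mul (norm_mul_le _ _) np (norm_nonneg _) (by positivity)).trans ?_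
      nlinarith [norm_nonneg x, norm_nonneg p]
    rw [e]
    refine (norm_add_le _ _).trans_lt ?_
    rw [norm_neg]
    have b₁ : ‖star v * (v * star v - q) * v‖ ≤ 11 / 100 := by
      refine (norm_mul_le _ _).trans ?_
      refine (mul_le_mul_of_nonneg_right (norm_mul_le _ _) (norm_nonneg _)).trans ?_
      rw [norm_star]
      nlinarith [norm_nonneg v, norm_nonneg (v * star v - q),
        mul_nonneg (norm_nonneg v) (norm_nonneg v)]
    have b₂ : ‖(star v * v - p) * (star v * v) + p * (star v * v - p)‖ ≤ 21 / 100 := by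
      refine (norm_add_le _ _).trans ?_
      have c₁ := norm_mul_le (star v * v - p) (star v * v)
      have c₂ := norm_mul_le p (star v * v - p)
      nlinarith [norm_nonneg (star v * v - p), norm_nonneg (star v * v), norm_nonneg p]
    linarith [sandwich (star v * (v * star v - q) * v),
      sandwich ((star v * v - p) * (star v * v) + p * (star v * v - p))]
  have hpp : p * p = p := hp.isIdempotentElem
  have hqq : q * q = q := hq.isIdempotentElem
  have hps : star p = p := hp.isSelfAdjoint
  have hqs : star q = q := hq.isSelfAdjoint
  have unit_of_close : ∀ {x p : D}, ‖x - p‖ < 1 → IsUnit (x + (1 - p)) := by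
    intro x p h
    have := (Units.oneSub (p - x) (by rwa [norm_sub_rev])).isUnit
    rw [Units.val_oneSub] at this
    convert this using 1
    abel
  set w := q * v * p with hw
  have hwp : w * p = w := by rw [hw, mul_assoc, hpp]
  have hqw : q * w = w := by rw [hw, ← mul_assoc, ← mul_assoc, hqq]
  have hpw : p * star w = star w := by
    have := congrArg star hwp; rwa [star_mul, hps] at this
  have hwq : star w * q = star w := by
    have := congrArg star hqw; rwa [star_mul, hqs] at this
  have hsw : star w = p * star v * q := by rw [hw]; simp [hps, hqs, mul_assoc]
  have uh : IsUnit (star w * w + (1 - p)) := unit_of_close (close hp hq h₁ h₂)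
  have uk : IsUnit (w * star w + (1 - q)) := by
    refine unit_of_close ?_
    have := close (v := star v) hq hp (by rwa [star_star]) (by rwa [star_star])
    rwa [← hsw, star_star] at this
  -- Since `h` commutes with `p` and `h p = w⋆w`, compression by `p` turns `h` into `w⋆w`.
  set h := star w * w + (1 - p) with hh
  have h0 : 0 ≤ h := add_nonneg (star_mul_self_nonneg w) hp.one_sub.nonneg
  have hph : p * h = star w * w := by
    rw [hh, mul_add, mul_sub, ← mul_assoc, hpw, hpp, mul_one, sub_self, add_zero]
  have hhp : h * p = star w * w := by
    rw [hh, add_mul, sub_mul, mul_assoc, hwp, hpp, one_mul, sub_self, add_zero]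
  set s := CFC.sqrt h with hs
  have hss : s * s = h := CFC.sqrt_mul_sqrt_self h h0
  have hsa : star s = s := (CFC.sqrt_nonneg h).isSelfAdjoint
  have hsp : Commute s p := by
    rw [hs, CFC.sqrt]
    exact Commute.cfcₙ_nnreal (hhp.trans hph.symm) _
  obtain ⟨S, hS⟩ : IsUnit s := by
    rw [← hss] at uh
    exact ((Commute.refl s).isUnit_mul_iff.1 uh).1
  -- `t` is `h^(-1/2)`.
  obtain ⟨t, hts, hst⟩ : ∃ t : D, t * s = 1 ∧ s * t = 1 :=
    ⟨↑S⁻¹, by rw [← hS, Units.inv_mul], by rw [← hS, Units.mul_inv]⟩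
  have hta : star t = t := by
    have h' : star t * s = 1 := by
      have := congrArg star hst
      rwa [star_mul, hsa, star_one] at this
    exact left_inv_eq_right_inv h' hst
  have htp : t * p = p * t := by
    calc t * p = t * (p * s) * t := by rw [mul_assoc, mul_assoc, hst, mul_one]
      _ = p * t := by rw [← hsp.eq, ← mul_assoc, hts, one_mul]
  refine ⟨w * t, ?_, ?_⟩
  · calc star (w * t) * (w * t) = t * (star w * w) * t := by
          rw [star_mul, hta]; simp only [mul_assoc]
      _ = p * (t * s) * (s * t) := by
          rw [← hph, ← hss, ← mul_assoc t, htp]; simp only [mul_assoc]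
      _ = p := by rw [hts, hst, mul_one, mul_one]
  · have e₁ : w * t * star (w * t) * (w * star w + (1 - q)) = w * star w := by
      have z : star w * (1 - q) = 0 := by rw [mul_sub, mul_one, hwq, sub_self]
      calc w * t * star (w * t) * (w * star w + (1 - q))
          = w * t * t * (star w * w) * star w + w * t * t * (star w * (1 - q)) := by
            rw [star_mul, hta]; simp only [mul_add, mul_assoc]
        _ = w * (t * (t * s) * s) * p * star w := by
            rw [z, mul_zero, add_zero, ← hhp, ← hss]; simp only [mul_assoc]
        _ = w * star w := by rw [hts, mul_one, hts, mul_one, mul_assoc, hpw]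
    -- Both `(w t)(w t)⋆` and `q` give `ww⋆` when multiplied by the unit `ww⋆ + (1 - q)`.
    have e₂ : q * (w * star w + (1 - q)) = w * star w := by
      rw [mul_add, mul_sub, ← mul_assoc, hqw, hqq, mul_one, sub_self, add_zero]
    exact uk.mul_right_cancel (e₁.trans e₂.symm)

/-- An injective `⋆`-homomorphism reflects positivity, since it commutes with taking negative
parts. -/
theorem nonneg_of_map_nonneg {A B : Type*} [NonUnitalCStarAlgebra A] [NonUnitalCStarAlgebra B]
    [PartialOrder A] [StarOrderedRing A] [PartialOrder B] [StarOrderedRing B] (φ : A →⋆ₙₐ[ℂ] B)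
    (hφ : Function.Injective φ) {a : A} (h : 0 ≤ φ a) : 0 ≤ a := by
  rw [CStarAlgebra.nonneg_iff_isSelfAdjoint_and_negPart_eq_zero] at h ⊢
  obtain ⟨h₁, h₂⟩ := h
  have sa : IsSelfAdjoint a := hφ (by rw [map_star, h₁.star_eq])
  refine ⟨sa, hφ ?_⟩
  have hc : Continuous φ := (NonUnitalStarAlgHom.isometry φ hφ).continuous
  rw [map_zero, ← h₂, CFC.negPart_def, CFC.negPart_def]
  exact NonUnitalStarAlgHomClass.map_cfcₙ (S := ℂ) φ _ a

/-- The product `exp (i h₁) ⋯ exp (i hₖ)` over a list of elements of a `C⋆`-algebra. The elements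
are not required to be self-adjoint; when they are, this is a unitary connected to `1`. -/
noncomputable def expProd {D : Type*} [CStarAlgebra D] (l : List D) : D :=
  (l.map fun h => NormedSpace.exp (Complex.I • h)).prod

theorem map_expProd {D E : Type*} [CStarAlgebra D] [CStarAlgebra E] (φ : D →⋆ₐ[ℂ] E)
    (l : List D) : φ (expProd l) = expProd (l.map φ) := by
  have hc : Continuous φ := AddMonoidHomClass.continuous_of_bound φ 1 fun x => by
      simpa using NonUnitalStarAlgHom.norm_apply_le φ x
  let _ : NormedAlgebra ℚ D := .restrictScalars ℚ ℂ D
  let _ : NormedAlgebra ℚ E := .restrictScalars ℚ ℂ E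
  rw [expProd, expProd, map_list_prod, List.map_map, List.map_map]
  congr 2
  ext h
  simp only [Function.comp_apply]
  rw [NormedSpace.map_exp φ hc, map_smul]

theorem coe_prod_expUnitary {D : Type*} [CStarAlgebra D] (l : List (selfAdjoint D)) :
    (((l.map selfAdjoint.expUnitary).prod : unitary D) : D) = expProd (l.map (↑)) := by
  rw [expProd, List.map_map]
  exact (map_list_prod (unitary D).subtype _).trans (by rw [List.map_map]; rfl)

theorem exists_expProd_eq_of_joined_one {D : Type*} [CStarAlgebra D] {u : unitary D}
    (h : Joined 1 u) : ∃ l : List D, (∀ h ∈ l, IsSelfAdjoint h) ∧ expProd l = u := by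
  obtain ⟨l, rfl⟩ := Unitary.mem_pathComponentOne_iff.1 h
  exact ⟨l.map (↑), fun h hh => by obtain ⟨a, -, rfl⟩ := List.mem_map.1 hh; exact a.2,
    (coe_prod_expUnitary l).symm⟩

theorem joined_one_of_norm_expProd_sub_lt {D : Type*} [CStarAlgebra D] {u : unitary D} {l : List D}
    (hl : ∀ h ∈ l, IsSelfAdjoint h) (h : ‖expProd l - u‖ < 2) : Joined 1 u := by
  lift l to List (selfAdjoint D) using hl
  rw [← coe_prod_expUnitary] at h
  have h₁ : (l.map selfAdjoint.expUnitary).prod ∈ pathComponent (1 : unitary D) :=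
    Unitary.mem_pathComponentOne_iff.2 ⟨l, rfl⟩
  exact Joined.trans h₁ (Unitary.joined _ _ (by rwa [norm_sub_rev]))

/-! ### Injectivity and surjectivity criteria in `K`-theory -/

theorem Unitization.mem_range_starMap {A D : Type*} [NonUnitalCStarAlgebra A]
    [NonUnitalCStarAlgebra D] (φ : D →⋆ₙₐ[ℂ] A)
    {x : Unitization ℂ A} : x ∈ Set.range (Unitization.starMap φ) ↔ x.snd ∈ Set.range φ := by
  constructor
  · rintro ⟨y, rfl⟩
    exact ⟨y.snd, by simp [Unitization.algebraMap_eq_inl]⟩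
  · rintro ⟨d, hd⟩
    exact ⟨Unitization.inl x.fst + Unitization.inr d, by
      ext <;> simp [hd, Unitization.algebraMap_eq_inl]⟩

namespace CStarKTheory

section Criteria

open Matrix

variable {B C : Type*} [CStarAlgebra B] [CStarAlgebra C]

theorem V.mk_zero_eq_zero (n : ℕ) : V.mk (⟨n, 0, .zero _⟩ : Proj B) = 0 :=
  V.mk_eq_mk.2 ⟨0, by simp, by simp⟩

/-- To test injectivity on `V` it is enough to compare projections of equal size, because a
projection is equivalent to its enlargements by zero blocks. -/
theorem V.map_injective_of_forall_mvN (φ : B →⋆ₐ[ℂ] C)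
    (H : ∀ (n : ℕ) (P Q : Matrix (Fin n) (Fin n) B), IsStarProjection P → IsStarProjection Q →
      MvN (P.map φ) (Q.map φ) → MvN P Q) : Function.Injective (V.map φ) := by
  rintro ⟨p⟩ ⟨q⟩ h
  let Z (n : ℕ) : Proj B := ⟨n, 0, .zero _⟩
  have hp : V.mk p = V.mk (p.directSum (Z q.size)) := by
    rw [← V.mk_add_mk, V.mk_zero_eq_zero, add_zero]
  have hq : V.mk q = V.mk ((Z p.size).directSum q) := by
    rw [← V.mk_add_mk, V.mk_zero_eq_zero, zero_add]
  change V.map φ (V.mk p) = V.map φ (V.mk q) at h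
  change V.mk p = V.mk q
  rw [hp, hq] at h ⊢
  exact V.mk_eq_mk.2 (H (p.size + q.size) _ _ (p.directSum _).isProj (Proj.directSum _ q).isProj
    (V.mk_eq_mk.1 h))

/-- Every class in `V(B)` is a summand of the class of an identity matrix, by
`(1 - r) ⊕ r ∼ 1` for a projection `r`. -/
theorem V.exists_add_eq_one (x : V B) : ∃ (y : V B) (k : ℕ), y + x = V.mk ⟨k, 1, .one _⟩ := by
  obtain ⟨r⟩ := x
  refine ⟨V.mk ⟨r.size, 1 - r.mat, r.isProj.one_sub⟩, r.size, ?_⟩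
  refine V.mk_eq_mk.2 (Proj.mvN_trans (Proj.directSum_mvN _ _).symm ?_)
  have hs : r.matᴴ = r.mat := r.isProj.isSelfAdjoint
  have hi : r.mat * r.mat = r.mat := r.isProj.isIdempotentElem
  refine ⟨Matrix.fromCols (1 - r.mat) r.mat, ?_, ?_⟩
  · rw [Matrix.conjTranspose_fromCols_eq_fromRows_conjTranspose, Matrix.fromRows_mul_fromCols]
    simp [hs, hi, mul_sub, sub_mul]
  · rw [Matrix.conjTranspose_fromCols_eq_fromRows_conjTranspose, Matrix.fromCols_mul_fromRows]
    simp [hs, hi, mul_sub, sub_mul]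

theorem K0Unital.exists_eq_sub (x : K0Unital B) : ∃ p q : Proj B,
    x = Algebra.GrothendieckAddGroup.of (V.mk p) - Algebra.GrothendieckAddGroup.of (V.mk q) := by
  obtain ⟨⟨⟨p⟩, ⟨⟨q⟩, _⟩⟩, h⟩ := (AddLocalization.addMonoidOf (⊤ : AddSubmonoid (V B))).surj x
  exact ⟨p, q, eq_sub_of_add_eq h⟩

/-- Injectivity passes from `V` to `K₀`: a stable equivalence over the target may be taken to be
stable equivalence by adding an identity matrix, and this is the image of one over the source. -/
theorem K0Unital.map_injective_of_injective_V_map (φ : B →⋆ₐ[ℂ] C)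
    (H : Function.Injective (V.map φ)) :
    Function.Injective (K0Unital.map φ) := by
  rw [injective_iff_map_eq_zero]
  intro x hx
  obtain ⟨p, q, rfl⟩ := K0Unital.exists_eq_sub x
  rw [map_sub, K0Unital.map_of, K0Unital.map_of, sub_eq_zero] at hx
  obtain ⟨⟨c, _⟩, hc⟩ :=
    (AddLocalization.addMonoidOf (⊤ : AddSubmonoid (V C))).eq_iff_exists.1 hx
  obtain ⟨d, k, hd⟩ := V.exists_add_eq_one c
  have h₁ : V.mk (⟨k, 1, .one _⟩ : Proj C) = V.map φ (V.mk ⟨k, 1, .one _⟩) :=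
    congrArg V.mk (Proj.mk_congr _ _ (Matrix.map_one _ (map_zero φ) (map_one φ)).symm)
  have h₂ := congrArg (d + ·) hc
  simp only [← add_assoc, hd, h₁, ← map_add] at h₂
  rw [sub_eq_zero]
  exact (AddLocalization.addMonoidOf (⊤ : AddSubmonoid (V B))).eq_iff_exists.2
    ⟨⟨_, trivial⟩, H h₂⟩

theorem K1Unital.map_injective_of_forall_joined (φ : B →⋆ₐ[ℂ] C)
    (H : ∀ (n : ℕ) (u : U B n), Joined 1 (U.map φ n u) → Joined 1 u) :
    Function.Injective (K1Unital.map φ) := by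
  rw [injective_iff_map_eq_one]
  refine DirectLimit.induction _ ?_
  rintro n ⟨u⟩ hx
  obtain ⟨m, h, e⟩ := (DirectLimit.exists_eq_one _).1 hx
  refine (DirectLimit.exists_eq_one _).2 ⟨m, h, ?_⟩
  refine (QuotientGroup.eq_one_iff _).2 (H m _ ?_)
  have := (QuotientGroup.eq_one_iff _).1 e
  rwa [show U.pad h (U.map φ n u) = U.map φ m (U.pad h u) from
    Subtype.ext (padMatrix_map h φ u.1)] at this

theorem isStarProjection_of_map (φ : B →⋆ₐ[ℂ] C) (hφ : Function.Injective φ) {n : ℕ}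
    {p : Matrix (Fin n) (Fin n) B} (h : IsStarProjection (p.map φ)) : IsStarProjection p := by
  have hm := Matrix.map_injective (m := Fin n) (n := Fin n) hφ
  refine ⟨hm ?_, hm ?_⟩ <;> dsimp only
  · rw [Matrix.map_mul, h.isIdempotentElem.eq]
  · rw [Matrix.star_eq_conjTranspose, Matrix.conjTranspose_map _ (map_star φ)]
    exact h.isSelfAdjoint

theorem U.exists_map_eq (φ : B →⋆ₐ[ℂ] C) (hφ : Function.Injective φ) {n : ℕ}
    (u : U C n) (h : ∀ i j, u.1 i j ∈ Set.range φ) : ∃ v : U B n, U.map φ n v = u := by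
  choose w hw using h
  have hw : Matrix.map (Matrix.of w) φ = u.1 := by ext i j; exact hw i j
  have hm := Matrix.map_injective (m := Fin n) (n := Fin n) hφ
  refine ⟨⟨Matrix.of w, Unitary.mem_iff.2 ⟨hm ?_, hm ?_⟩⟩, Subtype.ext hw⟩ <;>
  dsimp only <;>
  rw [Matrix.map_mul, Matrix.star_eq_conjTranspose, Matrix.conjTranspose_map _ (map_star φ), hw,
    Matrix.map_one _ (map_zero φ) (map_one φ), ← Matrix.star_eq_conjTranspose]
  · exact Unitary.star_mul_self_of_mem u.2
  · exact Unitary.mul_star_self_of_mem u.2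

theorem Proj.exists_map_eq (φ : B →⋆ₐ[ℂ] C) (hφ : Function.Injective φ)
    (p : Proj C) (h : ∀ i j, p.mat i j ∈ Set.range φ) : ∃ q : Proj B, Proj.map φ q = p := by
  choose w hw using h
  have hw : Matrix.map (Matrix.of w) φ = p.mat := by ext i j; exact hw i j
  exact ⟨⟨p.size, Matrix.of w, isStarProjection_of_map φ hφ (hw ▸ p.isProj)⟩, Proj.mk_congr _ _ hw⟩

end Criteria

section Representatives

universe u

variable {A : Type u} [NonUnitalCStarAlgebra A]

/-- A class in `K₁(A)` lifts to every subalgebra that contains a certain countable set, the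
entries, up to scalars, of a unitary matrix representing it. -/
theorem exists_countable_mem_range_K1_map (x : K1 A) : ∃ S : Set A, S.Countable ∧
    ∀ (D : Type u) [NonUnitalCStarAlgebra D] (φ : D →⋆ₙₐ[ℂ] A), Function.Injective φ →
      S ⊆ Set.range φ → x ∈ Set.range (K1.map φ) := by
  induction x using DirectLimit.induction with
  | _ n x =>
  obtain ⟨u, rfl⟩ := QuotientGroup.mk_surjective x
  refine ⟨Set.range fun i : Fin n × Fin n => (u.1 i.1 i.2).snd, Set.countable_range _,
    fun D _ φ hφ h => ?_⟩
  obtain ⟨v, rfl⟩ := U.exists_map_eq (Unitization.starMap φ) (Unitization.starMap_injective hφ) u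
    fun i j => (Unitization.mem_range_starMap φ).2 (h ⟨(i, j), rfl⟩)
  exact ⟨⟦⟨n, QuotientGroup.mk v⟩⟧, rfl⟩

/-- A class in `K₀(A)` lifts to every subalgebra that contains a certain countable set, the
entries, up to scalars, of two projections whose formal difference represents it. -/
theorem exists_countable_mem_range_K0_map (x : K0 A) : ∃ S : Set A, S.Countable ∧
    ∀ (D : Type u) [NonUnitalCStarAlgebra D] (φ : D →⋆ₙₐ[ℂ] A), Function.Injective φ →
      S ⊆ Set.range φ → x ∈ Set.range (K0.map φ) := by
  obtain ⟨x, hx⟩ := x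
  obtain ⟨p, q, rfl⟩ := K0Unital.exists_eq_sub x
  refine ⟨(Set.range fun i : Fin p.size × Fin p.size => (p.mat i.1 i.2).snd) ∪
    Set.range fun i : Fin q.size × Fin q.size => (q.mat i.1 i.2).snd,
    (Set.countable_range _).union (Set.countable_range _), fun D _ φ hφ h => ?_⟩
  have hi := Unitization.starMap_injective hφ
  obtain ⟨p, rfl⟩ := Proj.exists_map_eq (Unitization.starMap φ) hi p
    fun i j => (Unitization.mem_range_starMap φ).2 (h (.inl ⟨(i, j), rfl⟩))
  obtain ⟨q, rfl⟩ := Proj.exists_map_eq (Unitization.starMap φ) hi q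
    fun i j => (Unitization.mem_range_starMap φ).2 (h (.inr ⟨(i, j), rfl⟩))
  have e : K0Unital.map (Unitization.starMap φ) (Algebra.GrothendieckAddGroup.of (V.mk p) -
      Algebra.GrothendieckAddGroup.of (V.mk q)) =
      Algebra.GrothendieckAddGroup.of (V.mk (p.map (Unitization.starMap φ))) -
      Algebra.GrothendieckAddGroup.of (V.mk (q.map (Unitization.starMap φ))) := by
    rw [map_sub, K0Unital.map_of, K0Unital.map_of, V.map_mk, V.map_mk]
  refine ⟨⟨Algebra.GrothendieckAddGroup.of (V.mk p) -
      Algebra.GrothendieckAddGroup.of (V.mk q), ?_⟩, Subtype.ext e⟩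
  change K0Unital.map _ _ = 0
  rw [← scalarPart_comp_starMap φ, K0Unital.map_comp, AddMonoidHom.comp_apply, e]
  exact hx

end Representatives

end CStarKTheory

/-! ### The closing-off construction -/

theorem Subsemigroup.countable_closure {M : Type*} [Semigroup M] {s : Set M} (hs : s.Countable) :
    (Subsemigroup.closure s : Set M).Countable := by
  have := hs.to_subtype
  -- Every element of the closure is a product `a * b₁ * ⋯ * bₖ` of a nonempty list in `s`.
  let g : M → s → M := fun a b => a * b
  have hg : ∀ (l : List s) (a b : M), l.foldl g (a * b) = a * l.foldl g b := fun l => by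
    induction l with
    | nil => exact fun _ _ => rfl
    | cons c l ih =>
      intro a b
      rw [List.foldl_cons, List.foldl_cons, ← ih]
      exact congrArg (fun t => l.foldl g t) (mul_assoc a b c)
  refine (Set.countable_range fun x : s × List s => x.2.foldl g x.1).mono fun x hx => ?_
  induction hx using Subsemigroup.closure_induction with
  | mem x hx => exact ⟨(⟨x, hx⟩, []), rfl⟩
  | mul x y _ _ hx hy =>
    obtain ⟨⟨a, l⟩, rfl⟩ := hx
    obtain ⟨⟨b, m⟩, rfl⟩ := hy
    refine ⟨(a, l ++ b :: m), ?_⟩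
    simp only [List.foldl_append, List.foldl_cons]
    exact hg m _ b

section ClosingOff

variable {A : Type*} [NonUnitalCStarAlgebra A]

theorem isSeparable_adjoin {S : Set A} (hS : S.Countable) :
    IsSeparable (NonUnitalStarAlgebra.adjoin ℂ S : Set A) := by
  have h := congrArg (fun p : Submodule ℂ A => (p : Set A)) 
    (NonUnitalStarAlgebra.adjoin_eq_span (R := ℂ) S)
  change (NonUnitalStarAlgebra.adjoin ℂ S : Set A) = _ at h
  rw [h]
  refine (Set.Countable.isSeparable (Subsemigroup.countable_closure (hS.union ?_))).span
  rw [← Set.image_star]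
  exact hS.image _

theorem isSeparable_snd_mem {F : Set A} (hF : IsSeparable F) :
    IsSeparable {x : Unitization ℂ A | x.snd ∈ F} := by
  refine (((IsSeparable.of_separableSpace (Set.univ : Set ℂ)).prod hF).image
    (f := fun z : ℂ × A => (Unitization.inl z.1 + Unitization.inr z.2 : Unitization ℂ A))
      ?_).mono ?_
  · have h := continuous_algebraMap ℂ (Unitization ℂ A)
    rw [Unitization.algebraMap_eq_inl] at h
    exact (h.comp continuous_fst).add
      (Unitization.continuous_inr.comp continuous_snd)
  · intro x hx
    exact ⟨(x.fst, x.snd), ⟨trivial, hx⟩, Unitization.inl_fst_add_inr_snd_eq x⟩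

/-- Let `W` assign a countable set of witnesses in `A` to every finite tuple of parameters in the
unitization of `A`. There is an increasing sequence of separable `C⋆`-subalgebras such that any
tuple over the closure of their union can be approximated by tuples whose witnesses lie in the
union. The approximating tuples need not themselves be over the union. -/
theorem exists_closing_off {ι : ℕ → Type*} [∀ n, Finite (ι n)]
    (W : ∀ n, (ι n → Unitization ℂ A) → Set A) (hW : ∀ n x, (W n x).Countable) {S₀ : Set A}
    (hS₀ : S₀.Countable) :
    ∃ F : ℕ → NonUnitalStarSubalgebra ℂ A, (∀ n, IsClosed (F n : Set A)) ∧ Monotone F ∧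
      (∀ n, IsSeparable (F n : Set A)) ∧ (∀ n, S₀ ⊆ F n) ∧
      ∀ (n : ℕ) (x : ι n → Unitization ℂ A),
        (∀ i, (x i).snd ∈ closure (⋃ k, (F k : Set A))) →
          ∀ N ∈ 𝓝 x, ∃ y ∈ N, W n y ⊆ ⋃ k, (F k : Set A) := by
  let T := {S : Set A // S.Countable}
  let alg : T → NonUnitalStarSubalgebra ℂ A := fun S =>
    (NonUnitalStarAlgebra.adjoin ℂ S.1).topologicalClosure
  have halg : ∀ S, IsSeparable (alg S : Set A) := fun S => (isSeparable_adjoin S.2).closure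
  have hsub : ∀ S : T, S.1 ⊆ alg S := fun S =>
    (NonUnitalStarAlgebra.subset_adjoin ℂ S.1).trans
      (NonUnitalStarSubalgebra.le_topologicalClosure _)
  have hpi : ∀ (S : T) (n : ℕ), IsSeparable
      {x : ι n → Unitization ℂ A | ∀ i, x i ∈ {z | z.snd ∈ (alg S : Set A)}} := fun S n =>
    isSeparable_pi fun _ => isSeparable_snd_mem (halg S)
  choose C hC hCd using hpi
  let next : T → T := fun S => ⟨S.1 ∪ ⋃ n, ⋃ y ∈ C S n, W n y,
    S.2.union (Set.countable_iUnion fun n => (hC S n).biUnion fun y _ => hW n y)⟩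
  let S : ℕ → T := fun k => Nat.rec ⟨S₀, hS₀⟩ (fun _ => next) k
  have hS : Monotone fun k => (S k).1 := monotone_nat_of_le_succ fun k => Set.subset_union_left
  have hF : Monotone fun k => alg (S k) := fun i j h =>
    NonUnitalStarSubalgebra.topologicalClosure_mono (NonUnitalStarAlgebra.adjoin_mono (hS h))
  refine ⟨fun k => alg (S k), fun _ => NonUnitalStarSubalgebra.isClosed_topologicalClosure _, hF,
    fun _ => halg _, fun k => (hS (Nat.zero_le k)).trans (hsub (S k)), fun n x hx N hN => ?_⟩
  -- Approximate `x` by a tuple `y` over some stage `m`, and `y` by a parameter handled at `m + 1`.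
  have hx' : x ∈ closure
      {y : ι n → Unitization ℂ A | ∀ i, (y i).snd ∈ ⋃ k, (alg (S k) : Set A)} := by
    have : {y : ι n → Unitization ℂ A | ∀ i, (y i).snd ∈ ⋃ k, (alg (S k) : Set A)} =
        Set.univ.pi fun _ => {z | z.snd ∈ ⋃ k, (alg (S k) : Set A)} := by ext; simp
    rw [this, closure_pi_set]
    intro i _
    have hc : Continuous fun a : A =>
        (Unitization.inl (x i).fst + Unitization.inr a : Unitization ℂ A) :=
      continuous_const.add Unitization.continuous_inr
    have := map_mem_closure hc (hx i) (t := {z | z.snd ∈ ⋃ k, (alg (S k) : Set A)})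
      fun a ha => by simpa using ha
    rwa [Unitization.inl_fst_add_inr_snd_eq] at this
  obtain ⟨O, hON, hO, hxO⟩ := mem_nhds_iff.1 hN
  obtain ⟨y, hyO, hy⟩ := mem_closure_iff.1 hx' O hO hxO
  simp only [Set.mem_ofPred_eq, Set.mem_iUnion] at hy
  choose k hk using hy
  obtain ⟨m, hm⟩ := (Set.finite_range k).bddAbove
  have hym : y ∈ {x : ι n → Unitization ℂ A | ∀ i, x i ∈ {z | z.snd ∈ (alg (S m) : Set A)}} :=
    fun i => hF (hm ⟨i, rfl⟩) (hk i)
  obtain ⟨z, hzO, hz⟩ := mem_closure_iff.1 (hCd (S m) n hym) O hO hyO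
  refine ⟨z, hON hzO, ?_⟩
  refine Set.Subset.trans ?_ (Set.subset_iUnion _ (m + 1))
  refine Set.Subset.trans ?_ (hsub (S (m + 1)))
  exact Set.subset_union_of_subset_right (Set.subset_iUnion_of_subset n
    (Set.subset_biUnion_of_mem (u := fun y => W n y) hz)) _

end ClosingOff

/-! ### Matrices over a subalgebra -/

section Matrices

variable {B C : Type*} [CStarAlgebra B] [CStarAlgebra C]

/-- The unital `⋆`-homomorphism on `n × n` matrices obtained by applying `φ` to each entry. -/
noncomputable def CStarMatrix.mapStarAlgHom (φ : B →⋆ₐ[ℂ] C) (n : ℕ) :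
    CStarMatrix (Fin n) (Fin n) B →⋆ₐ[ℂ] CStarMatrix (Fin n) (Fin n) C :=
  { CStarMatrix.mapₙₐ (n := Fin n) (φ : B →⋆ₙₐ[ℂ] C) with
    map_one' := Matrix.map_one _ (map_zero φ) (map_one φ)
    commutes' := fun r => by
      ext i j
      change φ _ = _
      rw [CStarMatrix.algebraMap_apply, CStarMatrix.algebraMap_apply]
      split_ifs
      exacts [AlgHomClass.commutes φ r, map_zero φ] }

theorem CStarMatrix.mapStarAlgHom_injective (φ : B →⋆ₐ[ℂ] C) (hφ : Function.Injective φ) (n : ℕ) :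
    Function.Injective (mapStarAlgHom φ n) := fun M N h => by
  ext i j
  exact hφ (congrFun (congrFun h i) j)

theorem CStarMatrix.exists_mapStarAlgHom_eq (φ : B →⋆ₐ[ℂ] C) {n : ℕ}
    (M : CStarMatrix (Fin n) (Fin n) C) (h : ∀ i j, M i j ∈ Set.range φ) :
    ∃ N, mapStarAlgHom φ n N = M := by
  choose N hN using h
  exact ⟨CStarMatrix.ofMatrix N, by ext i j; exact hN i j⟩

/-- The identity map from unitary matrices to unitaries of the `C⋆`-algebra of matrices, as a
homeomorphism: both sides carry the topology of entrywise convergence. -/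
noncomputable def CStarMatrix.unitaryOfMatrix (n : ℕ) :
    U B n ≃ₜ unitary (CStarMatrix (Fin n) (Fin n) B) where
  toFun u := ⟨CStarMatrix.ofMatrix u.1, u.2⟩
  invFun u := ⟨CStarMatrix.ofMatrix.symm u.1, u.2⟩
  left_inv _ := rfl
  right_inv _ := rfl
  continuous_toFun := Continuous.subtype_mk
    (CStarMatrix.ofMatrixL.continuous.comp continuous_subtype_val) _
  continuous_invFun := Continuous.subtype_mk
    (CStarMatrix.ofMatrixL.symm.continuous.comp continuous_subtype_val) _

theorem joined_unitaryOfMatrix_iff {n : ℕ} {u : U B n} :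
    Joined 1 (CStarMatrix.unitaryOfMatrix n u) ↔ Joined 1 u :=
  ⟨fun ⟨γ⟩ => ⟨γ.map (CStarMatrix.unitaryOfMatrix n).symm.continuous⟩,
    fun ⟨γ⟩ => ⟨γ.map (CStarMatrix.unitaryOfMatrix n).continuous⟩⟩

variable [PartialOrder B] [StarOrderedRing B] [PartialOrder C] [StarOrderedRing C]

/-- Approximate Murray-von Neumann equivalence of `φ(p)` and `φ(q)`, implemented by a matrix with
entries in the range of `φ`, gives Murray-von Neumann equivalence of `p` and `q`. -/
theorem mvN_of_norm_sub_lt (φ : B →⋆ₐ[ℂ] C) (hφ : Function.Injective φ) {n : ℕ}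
    {p q : Matrix (Fin n) (Fin n) B} (hp : IsStarProjection p) (hq : IsStarProjection q)
    {v : CStarMatrix (Fin n) (Fin n) C} (hv : ∀ i j, v i j ∈ Set.range φ)
    (h₁ : ‖star v * v - CStarMatrix.ofMatrix (p.map φ)‖ < 1 / 10)
    (h₂ : ‖v * star v - CStarMatrix.ofMatrix (q.map φ)‖ < 1 / 10) : MvN p q := by
  obtain ⟨w, rfl⟩ := CStarMatrix.exists_mapStarAlgHom_eq φ v hv
  have hi := CStarMatrix.mapStarAlgHom_injective φ hφ n
  have hp' : CStarMatrix.ofMatrix (p.map φ) =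
    CStarMatrix.mapStarAlgHom φ n (CStarMatrix.ofMatrix p) := rfl
  have hq' : CStarMatrix.ofMatrix (q.map φ) =
    CStarMatrix.mapStarAlgHom φ n (CStarMatrix.ofMatrix q) := rfl
  rw [hp', ← map_star, ← map_mul, ← map_sub, NonUnitalStarAlgHom.norm_map _ hi] at h₁
  rw [hq', ← map_star, ← map_mul, ← map_sub, NonUnitalStarAlgHom.norm_map _ hi] at h₂
  have hpp : IsStarProjection (CStarMatrix.ofMatrix p) := ⟨hp.1, hp.2⟩
  have hqq : IsStarProjection (CStarMatrix.ofMatrix q) := ⟨hq.1, hq.2⟩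
  obtain ⟨u, hu₁, hu₂⟩ := exists_partialIsometry_of_norm_sub_lt hpp hqq h₁ h₂
  exact ⟨CStarMatrix.ofMatrix.symm u, hu₁, hu₂⟩

theorem exists_expProd_eq_ofMatrix {n : ℕ} {u : U B n} (h : Joined 1 u) :
    ∃ l : List (CStarMatrix (Fin n) (Fin n) B), (∀ h ∈ l, IsSelfAdjoint h) ∧
      expProd l = CStarMatrix.ofMatrix u.1 :=
  exists_expProd_eq_of_joined_one (joined_unitaryOfMatrix_iff.2 h)

/-- If `φ(u)` is close to a product of exponentials of self-adjoint matrices with entries in the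
range of `φ`, then `u` is connected to `1`. -/
theorem joined_one_of_norm_expProd_map_sub_lt (φ : B →⋆ₐ[ℂ] C) (hφ : Function.Injective φ) {n : ℕ}
    {u : U B n} {l : List (CStarMatrix (Fin n) (Fin n) C)} (hl : ∀ h ∈ l, IsSelfAdjoint h)
    (hr : ∀ h ∈ l, ∀ i j, h i j ∈ Set.range φ)
    (hu : ‖expProd l - CStarMatrix.ofMatrix (U.map φ n u).1‖ < 2) : Joined 1 u := by
  have hi := CStarMatrix.mapStarAlgHom_injective φ hφ n
  obtain ⟨m, rfl⟩ : ∃ m, List.map (CStarMatrix.mapStarAlgHom φ n) m = l :=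
    Set.mem_range.1 (Set.range_list_map _ ▸ fun h hh =>
      CStarMatrix.exists_mapStarAlgHom_eq φ h (hr h hh))
  have hu' : CStarMatrix.ofMatrix (U.map φ n u).1 =
    CStarMatrix.mapStarAlgHom φ n (CStarMatrix.unitaryOfMatrix n u) := rfl
  rw [hu', ← map_expProd, ← map_sub, NonUnitalStarAlgHom.norm_map _ hi] at hu
  refine joined_unitaryOfMatrix_iff.1 (joined_one_of_norm_expProd_sub_lt (fun h hh => hi ?_) hu)
  rw [map_star]
  exact hl _ (List.mem_map_of_mem hh)

end Matrices

/-! ### Completely positive maps and nuclearity of a subalgebra -/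

section Nuclear

open scoped CStarAlgebra

variable {A D M : Type*} [NonUnitalCStarAlgebra A] [NonUnitalCStarAlgebra D]
  [NonUnitalCStarAlgebra M] [PartialOrder A] [StarOrderedRing A] [PartialOrder D]
  [StarOrderedRing D] [PartialOrder M] [StarOrderedRing M]

theorem CompletelyPositiveMap.exists_comp (ψ : A →CP M) (φ : D →⋆ₙₐ[ℂ] A) :
    ∃ ψ' : D →CP M, ∀ d, ψ' d = ψ (φ d) :=
  ⟨{ ψ.toLinearMap ∘ₗ (φ : D →ₗ[ℂ] A) with
      map_cstarMatrix_nonneg' := fun k x hx => ψ.map_cstarMatrix_nonneg' k (x.map φ)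
        (CompletelyPositiveMapClass.map_cstarMatrix_nonneg' φ k x hx) }, fun _ => rfl⟩

/-- A completely positive map whose range lies in that of an injective `⋆`-homomorphism `φ` lifts
through `φ` to a completely positive map. -/
theorem CompletelyPositiveMap.exists_lift (ω : M →CP A) (φ : D →⋆ₙₐ[ℂ] A)
    (hφ : Function.Injective φ) (h : ∀ x, ω x ∈ Set.range φ) :
    ∃ ω' : M →CP D, ∀ x, φ (ω' x) = ω x := by
  let e := LinearEquiv.ofInjective (φ : D →ₗ[ℂ] A) hφ
  let g : M →ₗ[ℂ] D := e.symm.toLinearMap ∘ₗ ω.toLinearMap.codRestrict _ h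
  have hg : ∀ x, φ (g x) = ω x := fun x => congrArg Subtype.val (e.apply_symm_apply ⟨ω x, h x⟩)
  refine ⟨{ g with map_cstarMatrix_nonneg' := fun k x hx => ?_ }, hg⟩
  refine nonneg_of_map_nonneg (CStarMatrix.mapₙₐ (n := Fin k) φ) (fun a b hab => ?_) ?_
  · ext i j
    exact hφ (congrFun (congrFun hab i) j)
  · convert ω.map_cstarMatrix_nonneg' k x hx using 1
    ext i j
    exact hg _

end Nuclear

open scoped CStarAlgebra in
/-- A subalgebra is nuclear if its inclusion is a point-norm limit of completely positive
contractions `A → M_k(ℂ) → A` whose second map takes values in the subalgebra. -/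
theorem isNuclearCStar_of_injective {A D : Type*} [NonUnitalCStarAlgebra A]
    [NonUnitalCStarAlgebra D] (φ : D →⋆ₙₐ[ℂ] A) (hφ : Function.Injective φ)
    (h : letI : PartialOrder A := CStarAlgebra.spectralOrder A
      haveI : StarOrderedRing A := CStarAlgebra.spectralOrderedRing A
      letI : PartialOrder ℂ := CStarAlgebra.spectralOrder ℂ
      haveI : StarOrderedRing ℂ := CStarAlgebra.spectralOrderedRing ℂ
      ∀ (X : Finset D) (ε : ℝ), 0 < ε →
        ∃ (k : ℕ) (ψ : A →CP CStarMatrix (Fin k) (Fin k) ℂ)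
          (ω : CStarMatrix (Fin k) (Fin k) ℂ →CP A),
          (∀ a, ‖ψ a‖ ≤ ‖a‖) ∧ (∀ x, ‖ω x‖ ≤ ‖x‖) ∧ (∀ x, ω x ∈ Set.range φ) ∧
            ∀ d ∈ X, ‖ω (ψ (φ d)) - φ d‖ < ε) : IsNuclearCStar D := by
  let _ : PartialOrder A := CStarAlgebra.spectralOrder A
  have : StarOrderedRing A := CStarAlgebra.spectralOrderedRing A
  let _ : PartialOrder D := CStarAlgebra.spectralOrder D
  have : StarOrderedRing D := CStarAlgebra.spectralOrderedRing D
  let _ : PartialOrder ℂ := CStarAlgebra.spectralOrder ℂ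
  have : StarOrderedRing ℂ := CStarAlgebra.spectralOrderedRing ℂ
  intro X ε hε
  have hn := NonUnitalStarAlgHom.norm_map φ hφ
  obtain ⟨k, ψ, ω, hψ, hω, hr, hX⟩ := h X ε hε
  obtain ⟨ψ', hψ'⟩ := ψ.exists_comp φ
  obtain ⟨ω', hω'⟩ := ω.exists_lift φ hφ hr
  refine ⟨k, ψ', ω', fun d => ?_, fun x => ?_, fun d hd => ?_⟩
  · rw [hψ', ← hn]; exact hψ _
  · rw [← hn, hω']; exact hω _
  · rw [← hn, map_sub, hω', hψ']; exact hX d hd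

/-! ### Countable sets of witnesses -/

section Witnesses

variable {A : Type*} [NonUnitalCStarAlgebra A]

theorem exists_countable_mvN_witness [PartialOrder A] [StarOrderedRing A] {n : ℕ}
    (p q : CStarMatrix (Fin n) (Fin n) (Unitization ℂ A)) (ε : ℝ) : ∃ S : Set A, S.Countable ∧
      ((∃ v : CStarMatrix (Fin n) (Fin n) (Unitization ℂ A),
          ‖star v * v - p‖ < ε ∧ ‖v * star v - q‖ < ε) →
        ∃ v : CStarMatrix (Fin n) (Fin n) (Unitization ℂ A), (∀ i j, (v i j).snd ∈ S) ∧
          ‖star v * v - p‖ < ε ∧ ‖v * star v - q‖ < ε) := by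
  by_cases h : ∃ v : CStarMatrix (Fin n) (Fin n) (Unitization ℂ A),
    ‖star v * v - p‖ < ε ∧ ‖v * star v - q‖ < ε
  · obtain ⟨v, hv⟩ := h
    exact ⟨Set.range fun i : Fin n × Fin n => (v i.1 i.2).snd, Set.countable_range _,
      fun _ => ⟨v, fun i j => ⟨(i, j), rfl⟩, hv⟩⟩
  · exact ⟨∅, Set.countable_empty, fun h' => (h h').elim⟩

theorem exists_countable_expProd_witness [PartialOrder A] [StarOrderedRing A] {n : ℕ}
    (u : CStarMatrix (Fin n) (Fin n) (Unitization ℂ A)) (ε : ℝ) : ∃ S : Set A, S.Countable ∧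
      ((∃ l : List (CStarMatrix (Fin n) (Fin n) (Unitization ℂ A)),
          (∀ h ∈ l, IsSelfAdjoint h) ∧ ‖expProd l - u‖ < ε) →
        ∃ l : List (CStarMatrix (Fin n) (Fin n) (Unitization ℂ A)),
          (∀ h ∈ l, ∀ i j, (h i j).snd ∈ S) ∧
          (∀ h ∈ l, IsSelfAdjoint h) ∧ ‖expProd l - u‖ < ε) := by
  by_cases h : ∃ l : List (CStarMatrix (Fin n) (Fin n) (Unitization ℂ A)),
    (∀ h ∈ l, IsSelfAdjoint h) ∧ ‖expProd l - u‖ < ε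
  · obtain ⟨l, hl⟩ := h
    refine ⟨⋃ h ∈ {h | h ∈ l}, Set.range fun i : Fin n × Fin n => (h i.1 i.2).snd,
      l.finite_toSet.countable.biUnion fun _ _ => Set.countable_range _, fun _ => ⟨l, ?_, hl⟩⟩
    exact fun h hh i j => Set.mem_biUnion (show h ∈ {h | h ∈ l} from hh) ⟨(i, j), rfl⟩
  · exact ⟨∅, Set.countable_empty, fun h' => (h h').elim⟩

open scoped CStarAlgebra in
/-- For each finite set `X` in a nuclear algebra there is a countable set whose span contains the
ranges of the maps `M_k(ℂ) → A` of completely positive approximations on `X` to any accuracy. -/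
theorem IsNuclearCStar.exists_countable_witness (hA : IsNuclearCStar A) (X : Finset A) :
    letI : PartialOrder A := CStarAlgebra.spectralOrder A
    haveI : StarOrderedRing A := CStarAlgebra.spectralOrderedRing A
    letI : PartialOrder ℂ := CStarAlgebra.spectralOrder ℂ
    haveI : StarOrderedRing ℂ := CStarAlgebra.spectralOrderedRing ℂ
    ∃ S : Set A, S.Countable ∧ ∀ ε : ℝ, 0 < ε →
      ∃ (k : ℕ) (ψ : A →CP CStarMatrix (Fin k) (Fin k) ℂ)
        (ω : CStarMatrix (Fin k) (Fin k) ℂ →CP A),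
        (∀ a, ‖ψ a‖ ≤ ‖a‖) ∧ (∀ x, ‖ω x‖ ≤ ‖x‖) ∧ (∀ x, ω x ∈ Submodule.span ℂ S) ∧
          ∀ a ∈ X, ‖ω (ψ a) - a‖ < ε := by
  let _ : PartialOrder A := CStarAlgebra.spectralOrder A
  have : StarOrderedRing A := CStarAlgebra.spectralOrderedRing A
  let _ : PartialOrder ℂ := CStarAlgebra.spectralOrder ℂ
  have : StarOrderedRing ℂ := CStarAlgebra.spectralOrderedRing ℂ
  choose k ψ ω hψ hω hX using fun m : ℕ => hA X (1 / (m + 1)) Nat.one_div_pos_of_nat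
  have hfin (m : ℕ) : ∃ T : Finset (CStarMatrix (Fin (k m)) (Fin (k m)) ℂ),
      Submodule.span ℂ (T : Set (CStarMatrix (Fin (k m)) (Fin (k m)) ℂ)) = ⊤ :=
    (inferInstance : Module.Finite ℂ (Matrix (Fin (k m)) (Fin (k m)) ℂ)).fg_top
  choose T hT using hfin
  -- `ω m` is determined on the finite-dimensional algebra `M_k(ℂ)` by a finite spanning set.
  refine ⟨⋃ m, ω m '' T m, Set.countable_iUnion fun m => ((T m).countable_toSet.image _),
    fun ε hε => ?_⟩
  obtain ⟨m, hm⟩ := exists_nat_one_div_lt hε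
  refine ⟨k m, ψ m, ω m, hψ m, hω m, fun x => ?_, fun a ha => (hX m a ha).trans hm⟩
  refine Submodule.span_mono (Set.subset_iUnion (fun m => ω m '' T m) m) ?_
  have := Submodule.mem_map_of_mem (f := (ω m).toLinearMap) (hT m ▸ Submodule.mem_top (x := x))
  rwa [Submodule.map_span] at this

/-- The `c`-th of the two `n × n` matrices encoded by a tuple indexed by `Fin 2 × Fin n × Fin n`.
Two matrices are encoded so that one kind of tuple can carry a pair of projections; a single unitary
uses the first, and a finite set of `n` elements uses the rows of both. -/
def tupleMatrix {R : Type*} {n : ℕ} (c : Fin 2) (y : Fin 2 × Fin n × Fin n → R) :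
    CStarMatrix (Fin n) (Fin n) R :=
  CStarMatrix.ofMatrix (Matrix.of fun i j => y (c, i, j))

theorem eventually_norm_tupleMatrix_sub_lt [PartialOrder A] [StarOrderedRing A] {n : ℕ}
    (x : Fin 2 × Fin n × Fin n → Unitization ℂ A) {ε : ℝ} (hε : 0 < ε) (c : Fin 2) :
    ∀ᶠ y in 𝓝 x, ‖tupleMatrix c y - tupleMatrix c x‖ < ε := by
  have h : Continuous (tupleMatrix c : (Fin 2 × Fin n × Fin n → Unitization ℂ A) → _) :=
    CStarMatrix.ofMatrixL.continuous.comp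
      (continuous_matrix fun i j => continuous_apply (c, i, j))
  have := h.continuousAt.eventually (Metric.ball_mem_nhds (tupleMatrix c x) hε)
  simpa only [Metric.mem_ball, dist_eq_norm] using this

end Witnesses

/-! ### The separable subalgebra -/

/-- A nuclear algebra `A` contains a separable nuclear `C⋆`-subalgebra `θ`, the closure of an
increasing union of separable `C⋆`-subalgebras containing any prescribed countable set, such that
Murray-von Neumann equivalence of projections, and connectedness of unitaries to `1`, in matrices
over the unitization of `θ` can be tested over that of `A`. -/
theorem exists_separable_closing_off {A : Type*} [NonUnitalCStarAlgebra A] (hA : IsNuclearCStar A)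
    {S₀ : Set A} (hS₀ : S₀.Countable) :
    ∃ (F : ℕ → NonUnitalStarSubalgebra ℂ A) (_ : ∀ n, IsClosed (F n : Set A))
      (θ : NonUnitalStarSubalgebra ℂ A) (_ : IsClosed (θ : Set A)), Monotone F ∧
      (∀ n, SeparableSpace (F n)) ∧ (∀ n, S₀ ⊆ F n) ∧
      (θ : Set A) = closure (⋃ n, (F n : Set A)) ∧ SeparableSpace θ ∧ IsNuclearCStar θ ∧
      (∀ (n : ℕ) (p q : Matrix (Fin n) (Fin n) (Unitization ℂ θ)), IsStarProjection p →
        IsStarProjection q →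
        MvN (p.map (Unitization.starMap (NonUnitalStarSubalgebraClass.subtype θ)))
          (q.map (Unitization.starMap (NonUnitalStarSubalgebraClass.subtype θ))) → MvN p q) ∧
      ∀ (n : ℕ) (u : U (Unitization ℂ θ) n),
        Joined 1 (U.map (Unitization.starMap (NonUnitalStarSubalgebraClass.subtype θ)) n u) →
          Joined 1 u := by
  let _ : PartialOrder A := CStarAlgebra.spectralOrder A
  have : StarOrderedRing A := CStarAlgebra.spectralOrderedRing A
  -- The constants only have to satisfy `1 / 20 + 1 / 20 ≤ 1 / 10` and `1 + 1 ≤ 2`.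
  let ι : ℕ → Type := fun n => Fin 2 × Fin n × Fin n
  choose W₁ hW₁ H₁ using fun (n : ℕ) (y : ι n → Unitization ℂ A) =>
    exists_countable_mvN_witness (tupleMatrix 0 y) (tupleMatrix 1 y) (1 / 20)
  choose W₂ hW₂ H₂ using fun (n : ℕ) (y : ι n → Unitization ℂ A) =>
    exists_countable_expProd_witness (tupleMatrix 0 y) 1
  classical
  choose W₃ hW₃ H₃ using fun (n : ℕ) (y : ι n → Unitization ℂ A) =>
    hA.exists_countable_witness (Finset.univ.image fun i => (y i).snd)
  obtain ⟨F, hF, hmono, hsep, hS, H⟩ := exists_closing_off (ι := ι)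
    (fun n y => W₁ n y ∪ (W₂ n y ∪ W₃ n y))
    (fun n y => (hW₁ n y).union ((hW₂ n y).union (hW₃ n y))) hS₀
  have hco := NonUnitalStarSubalgebra.coe_iSup_of_directed hmono.directed_le
  let θ : NonUnitalStarSubalgebra ℂ A := (⨆ n, F n).topologicalClosure
  have hθ : (θ : Set A) = closure (⋃ n, (F n : Set A)) := by
    rw [← hco]; rfl
  have hθc : IsClosed (θ : Set A) := NonUnitalStarSubalgebra.isClosed_topologicalClosure _
  let _ : PartialOrder θ := CStarAlgebra.spectralOrder θ
  have : StarOrderedRing θ := CStarAlgebra.spectralOrderedRing θ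
  set φ : θ →⋆ₙₐ[ℂ] A := NonUnitalStarSubalgebraClass.subtype θ with hφdef
  have hφ : Function.Injective φ := Subtype.val_injective
  have hφr : ∀ a, a ∈ Set.range φ ↔ a ∈ θ := fun a => by
    rw [hφdef, NonUnitalStarSubalgebraClass.coe_subtype, Subtype.range_coe]; rfl
  have hΦ := Unitization.starMap_injective hφ
  have hmem : ∀ x : Unitization ℂ θ, (Unitization.starMap φ x).snd ∈ θ := fun x =>
    (hφr _).1 ((Unitization.mem_range_starMap φ).1 ⟨x, rfl⟩)
  have hU : (⋃ n, (F n : Set A)) ⊆ θ := hθ ▸ subset_closure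
  have hmem' : ∀ x : Unitization ℂ A, x.snd ∈ ⋃ n, (F n : Set A) →
      x ∈ Set.range (Unitization.starMap φ) := fun x hx =>
    (Unitization.mem_range_starMap φ).2 ((hφr _).2 (hU hx))
  have H' : ∀ (n : ℕ) (x : ι n → Unitization ℂ A), (∀ i, (x i).snd ∈ θ) → ∀ N ∈ 𝓝 x,
      ∃ y ∈ N, W₁ n y ∪ (W₂ n y ∪ W₃ n y) ⊆ ⋃ k, (F k : Set A) := fun n x hx =>
    H n x fun i => hθ ▸ hx i
  refine ⟨F, hF, θ, hθc, hmono, fun n => (hsep n).separableSpace, hS, hθ,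
    (hθ ▸ (IsSeparable.iUnion hsep).closure : IsSeparable (θ : Set A)).separableSpace, ?_, ?_, ?_⟩
  · refine isNuclearCStar_of_injective φ hφ ?_
    intro X ε hε
    let x : ι X.card → Unitization ℂ A := fun i => Unitization.inr (φ (X.equivFin.symm i.2.1))
    have hx : ∀ᶠ y in 𝓝 x, ∀ i, ‖(y i).snd - (x i).snd‖ < ε / 4 := by
      refine Filter.eventually_all.2 fun i => ?_
      have hc : Continuous fun y : ι X.card → Unitization ℂ A => (y i).snd :=
        Unitization.continuous_snd.comp (continuous_apply i)
      have := hc.continuousAt.eventually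
        (Metric.ball_mem_nhds (x i).snd (by positivity : 0 < ε / 4))
      simpa only [Metric.mem_ball, dist_eq_norm] using this
    obtain ⟨y, hyN, hy⟩ := H' _ x (fun i => (hφr _).1 ⟨_, rfl⟩) _ hx
    obtain ⟨k, ψ, ω, hψ, hω, hr, happ⟩ := H₃ _ y (ε / 4) (by positivity)
    have hW : Submodule.span ℂ (W₃ _ y) ≤ θ.toSubmodule := Submodule.span_le.2 fun a ha =>
      hU (hy (Or.inr (Or.inr ha)))
    refine ⟨k, ψ, ω, hψ, hω, fun z => (hφr _).2 (hW (hr z)), fun d hd => ?_⟩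
    let i : ι X.card := (0, X.equivFin ⟨d, hd⟩, X.equivFin ⟨d, hd⟩)
    have hxi : (x i).snd = φ d := by simp [x, i]
    have h₁ := hyN i
    have h₂ := happ (y i).snd (Finset.mem_image_of_mem _ (Finset.mem_univ i))
    rw [hxi] at h₁
    have h₃ : ‖ω (ψ (φ d)) - ω (ψ (y i).snd)‖ < ε / 4 := by
      rw [← map_sub, ← map_sub]
      exact ((hω _).trans (hψ _)).trans_lt (by rwa [norm_sub_rev])
    have h₄ := norm_sub_le_norm_sub_add_norm_sub (ω (ψ (φ d))) (ω (ψ (y i).snd)) (φ d)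
    have h₅ := norm_sub_le_norm_sub_add_norm_sub (ω (ψ (y i).snd)) (y i).snd (φ d)
    linarith
  · intro n p q hp hq ⟨v, hv₁, hv₂⟩
    let x : ι n → Unitization ℂ A := fun i =>
      Unitization.starMap φ (if i.1 = 0 then p i.2.1 i.2.2 else q i.2.1 i.2.2)
    obtain ⟨y, ⟨hy₀, hy₁⟩, hy⟩ := H' n x (fun i => hmem _) _
      ((eventually_norm_tupleMatrix_sub_lt x (ε := 1 / 20) (by norm_num) 0).and
        (eventually_norm_tupleMatrix_sub_lt x (ε := 1 / 20) (by norm_num) 1))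
    have hx₀ : tupleMatrix 0 x = CStarMatrix.ofMatrix (p.map (Unitization.starMap φ)) := rfl
    have hx₁ : tupleMatrix 1 x = CStarMatrix.ofMatrix (q.map (Unitization.starMap φ)) := rfl
    have hv₁ : star (CStarMatrix.ofMatrix v) * CStarMatrix.ofMatrix v = tupleMatrix 0 x := hv₁
    have hv₂ : CStarMatrix.ofMatrix v * star (CStarMatrix.ofMatrix v) = tupleMatrix 1 x := hv₂
    obtain ⟨w, hw, hw₁, hw₂⟩ := H₁ n y ⟨CStarMatrix.ofMatrix v, by
      rwa [hv₁, norm_sub_rev], by rwa [hv₂, norm_sub_rev]⟩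
    refine mvN_of_norm_sub_lt _ hΦ hp hq
      (fun i j => hmem' _ (hy (Or.inl (hw i j)))) ?_ ?_
    · rw [← hx₀]
      have := norm_sub_le_norm_sub_add_norm_sub (star w * w) (tupleMatrix 0 y) (tupleMatrix 0 x)
      linarith [hy₀]
    · rw [← hx₁]
      have := norm_sub_le_norm_sub_add_norm_sub (w * star w) (tupleMatrix 1 y) (tupleMatrix 1 x)
      linarith [hy₁]
  · intro n u hu
    obtain ⟨l, hl, hlu⟩ := exists_expProd_eq_ofMatrix hu
    let x : ι n → Unitization ℂ A := fun i => Unitization.starMap φ (u.1 i.2.1 i.2.2)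
    obtain ⟨y, hyN, hy⟩ := H' n x (fun i => hmem _) _
      (eventually_norm_tupleMatrix_sub_lt x (ε := 1) (by norm_num) 0)
    have hx₀ : tupleMatrix 0 x = CStarMatrix.ofMatrix (U.map (Unitization.starMap φ) n u).1 := rfl
    have hlu : expProd l = tupleMatrix 0 x := hlu
    obtain ⟨m, hm, hms, hmy⟩ := H₂ n y ⟨l, hl, by rw [hlu, norm_sub_rev]; exact hyN⟩
    refine joined_one_of_norm_expProd_map_sub_lt _ hΦ hms
      (fun h hh i j => hmem' _ (hy (Or.inr (Or.inl (hm h hh i j))))) ?_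
    rw [← hx₀]
    have := norm_sub_le_norm_sub_add_norm_sub (expProd m) (tupleMatrix 0 y) (tupleMatrix 0 x)
    have hyN : ‖tupleMatrix 0 y - tupleMatrix 0 x‖ < 1 := hyN
    linarith

theorem corollary10p7 {A : Type*} [NonUnitalCStarAlgebra A]
    (hK0 : Countable (CStarKTheory.K0 A)) (hK1 : Countable (CStarKTheory.K1 A))
    (hA : IsNuclearCStar A) :
    ∃ (F : ℕ → NonUnitalStarSubalgebra ℂ A) (_ : ∀ n, IsClosed (F n : Set A))
      (θA : NonUnitalStarSubalgebra ℂ A) (_ : IsClosed (θA : Set A)),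
      Monotone F ∧
      (∀ n, TopologicalSpace.SeparableSpace (F n)) ∧
      (∀ n, Function.Surjective
          (CStarKTheory.K0.map (NonUnitalStarSubalgebraClass.subtype (F n))) ∧
        Function.Surjective
          (CStarKTheory.K1.map (NonUnitalStarSubalgebraClass.subtype (F n)))) ∧
      (θA : Set A) = closure (⋃ n, (F n : Set A)) ∧
      TopologicalSpace.SeparableSpace θA ∧
      CStarKTheory.IsWeakKEquiv (NonUnitalStarSubalgebraClass.subtype θA) ∧
      IsNuclearCStar θA := by
  choose S₀ hS₀ H₀ using exists_countable_mem_range_K0_map (A := A)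
  choose S₁ hS₁ H₁ using exists_countable_mem_range_K1_map (A := A)
  obtain ⟨F, hF, θ, hθc, hmono, hsep, hS, hθ, hθsep, hnuc, hV, hU⟩ :=
    exists_separable_closing_off hA (S₀ := (⋃ x, S₀ x) ∪ ⋃ x, S₁ x)
      ((Set.countable_iUnion hS₀).union (Set.countable_iUnion hS₁))
  have hsurj : ∀ (E : NonUnitalStarSubalgebra ℂ A) [IsClosed (E : Set A)],
      (⋃ x, S₀ x) ∪ ⋃ x, S₁ x ⊆ (E : Set A) →
      Function.Surjective (K0.map (NonUnitalStarSubalgebraClass.subtype E)) ∧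
        Function.Surjective (K1.map (NonUnitalStarSubalgebraClass.subtype E)) := by
    intro E _ hE
    have hr : Set.range (NonUnitalStarSubalgebraClass.subtype E) = (E : Set A) :=
      Subtype.range_coe
    refine ⟨fun x => H₀ x E _ Subtype.val_injective ?_, fun x => H₁ x E _ Subtype.val_injective ?_⟩
    · exact hr ▸ ((Set.subset_iUnion S₀ x).trans Set.subset_union_left).trans hE
    · exact hr ▸ ((Set.subset_iUnion S₁ x).trans Set.subset_union_right).trans hE
  have hFθ : (F 0 : Set A) ⊆ θ :=
    hθ ▸ (Set.subset_iUnion (fun n => (F n : Set A)) 0).trans subset_closure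
  obtain ⟨h₀, h₁⟩ := hsurj θ ((hS 0).trans hFθ)
  refine ⟨F, hF, θ, hθc, hmono, hsep, fun n => hsurj (F n) (hS n), hθ, hθsep,
    ⟨⟨fun x y hxy => ?_, h₀⟩, K1Unital.map_injective_of_forall_joined _ hU, h₁⟩, hnuc⟩
  exact Subtype.ext (K0Unital.map_injective_of_injective_V_map _
    (V.map_injective_of_forall_mvN _ hV) (congrArg Subtype.val hxy))
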